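/- Let $n \geq 1$ be an integer, let $\boldsymbol\lambda = (\lambda_1, \dots, \lambda_n) \in \mathbb{C}^n$ satisfy $\sum_{l=1}^n \lambda_l = 0$, and let $\boldsymbol\varsigma = (\varsigma_1, \dots, \varsigma_n) \in \{+,-\}^n$. Write $e(a) = e^{2\pi i a}$, $L_\pm(\boldsymbol\varsigma) = \{ l : \varsigma_l = \pm \}$ and $n_\pm(\boldsymbol\varsigma) = |L_\pm(\boldsymbol\varsigma)|$. For $x > 0$ put $$J(x; \boldsymbol\varsigma, \boldsymbol\lambda) = \frac{1}{2\pi i} \int_{\mathcal{C}} \left( \prod_{l=1}^n \Gamma(s - \lambda_l)\, e\!\left( \frac{\varsigma_l (s - \lambda_l)}{4} \right) \right) x^{-ns}\, ds,$$ where $\mathcal{C}$ is a contour from $\rho - i\infty$ to $\rho + i\infty$ with $\rho < \frac12 - \frac1n$, vertical at infinity, that has all the points $\lambda_l - m$ ($1 \le l \le n$, $m = 0, 1, 2, \dots$) on its left; by Cauchy's theorem the value does not depend on the choice, and for definiteness take the polygonal path through $-1-i\infty$, $-1-iR$, $R-iR$, $R+iR$, $-1+iR$, $-1+i\infty$ with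 $R = 1+\sum_l|\lambda_l|$. Let $\mathbb{U}$ be the universal cover of $\mathbb{C} \smallsetminus \{0\}$, the Riemann surface of $\log z$, whose points $z = x e^{i\omega}$ are the pairs of a modulus $x > 0$ and an argument $\omega \in \mathbb{R}$. Then $J(x; \boldsymbol\varsigma, \boldsymbol\lambda)$ has a unique analytic continuation $J(z; \boldsymbol\varsigma, \boldsymbol\lambda)$ from $(0,\infty)$ (argument $0$) to $\mathbb{U}$, and with $H^\pm(z; \boldsymbol\lambda) = J(z; \pm, \dots, \pm, \boldsymbol\lambda)$ one has, for each of the two choices of sign and all $z \in \mathbb{U}$, $$J(z; \boldsymbol\varsigma, \boldsymbol\lambda) = e\!\left( \pm \frac{\sum_{l \in L_\mp(\boldsymbol\varsigma)} \lambda_l}{2} \right) H^\pm\!\left( e^{\pm \pi i \frac{n_\mp(\boldsymbol\varsigma)}{n}} z; \boldsymbol\lambda \right).$$ Here multiplication by $e^{i\theta}$ adds $\theta$ to the argument of a point of $\mathbb{U}$. -/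

import Mathlib

noncomputable section

namespace FundamentalBessel

/-- `e(a) = exp (2 π i a)`. -/
def e (a : ℂ) : ℂ := Complex.exp (2 * Real.pi * Complex.I * a)

/-! The Riemann surface of the logarithm. -/

/-- The universal cover of `ℂ ∖ {0}`: a point `z = x e^{iω}` is a pair of a modulus `x > 0` and an
argument `ω ∈ ℝ`, arguments that differ by a multiple of `2π` giving different points. -/
@[ext]
structure U where
  /-- the modulus -/
  modulus : ℝ
  /-- the argument, an arbitrary real number -/
  arg : ℝ
  modulus_pos : 0 < modulus

namespace U

/-- The point `e^w = e^{Re w} e^{i Im w}` of the universal cover, with argument `Im w`. -/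
def exp (w : ℂ) : U := ⟨Real.exp w.re, w.im, Real.exp_pos _⟩

/-- The logarithm `log z = log x + iω` of `z = x e^{iω}`. -/
def log (z : U) : ℂ := ⟨Real.log z.modulus, z.arg⟩

/-- The positive half line as a subset of the universal cover: argument `0`. -/
def ofPos (x : ℝ) (hx : 0 < x) : U := ⟨x, 0, hx⟩

/-- Moduli are multiplied and arguments are added. -/
instance : Mul U := ⟨fun z w => ⟨z.modulus * w.modulus, z.arg + w.arg,
  mul_pos z.modulus_pos w.modulus_pos⟩⟩

/-- The covering map onto `ℂ ∖ {0}`. -/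
def proj (z : U) : ℂ := z.modulus * Complex.exp (z.arg * Complex.I)

theorem log_exp (w : ℂ) : log (exp w) = w := by
  apply Complex.ext <;> simp [log, exp]

theorem exp_log (z : U) : exp (log z) = z := by
  ext <;> simp [log, exp, Real.exp_log z.modulus_pos]

theorem log_mul (z w : U) : log (z * w) = log z + log w := by
  apply Complex.ext
  · exact Real.log_mul z.modulus_pos.ne' w.modulus_pos.ne'
  · rfl

theorem proj_exp (w : ℂ) : proj (exp w) = Complex.exp w := by
  rw [Complex.exp_eq_exp_re_mul_sin_add_cos, proj, Complex.exp_mul_I]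
  simp [exp]

end U

/-- Holomorphy on the universal cover. The complex structure is the one for which the covering map
is locally biholomorphic; `log : U → ℂ` is then a global holomorphic coordinate with inverse
`U.exp`. -/
def IsHolomorphic (F : U → ℂ) : Prop := Differentiable ℂ fun w : ℂ => F (U.exp w)

/-- `F` is a holomorphic function on the universal cover that extends the function `f` on the
positive half line. -/
def IsAnalyticContinuation (f : ℝ → ℂ) (F : U → ℂ) : Prop :=
  IsHolomorphic F ∧ ∀ (x : ℝ) (hx : 0 < x), F (U.ofPos x hx) = f x

open Classical in
/-- The analytic continuation of `f : (0, ∞) → ℂ` onto the universal cover (zero if there is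
none). -/
def continuation (f : ℝ → ℂ) : U → ℂ :=
  if h : ∃ F : U → ℂ, IsAnalyticContinuation f F then h.choose else 0

/-! Bessel functions. The signs `+` and `-` are the units `1` and `-1` of `ℤ`. -/

/-- `L_ε(ς) = {l : ς_l = ε}`. -/
def L {n : ℕ} (ε : ℤˣ) (ς : Fin n → ℤˣ) : Finset (Fin n) := Finset.univ.filter fun l => ς l = ε

/-- `G(s; ς, λ) = ∏_l Γ(s - λ_l) e(ς_l (s - λ_l) / 4)`. -/
def G {n : ℕ} (ς : Fin n → ℤˣ) (lam : Fin n → ℂ) (s : ℂ) : ℂ :=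
  ∏ l, Complex.Gamma (s - lam l) * e (((ς l : ℤ) : ℂ) * (s - lam l) / 4)

/-- The integral of `f` along the contour that comes up the line `Re s = ρ` from `ρ - i∞` to
`ρ - iT`, passes through the corners `σ - iT` and `σ + iT` to `ρ + iT`, and goes up the line
`Re s = ρ` to `ρ + i∞`. -/
def contourIntegral (ρ σ T : ℝ) (f : ℂ → ℂ) : ℂ :=
  Complex.I * (∫ t in Set.Iic (-T), f (ρ + t * Complex.I))
    + (∫ u in ρ..σ, f (u - T * Complex.I))
    + Complex.I * (∫ t in (-T)..T, f (σ + t * Complex.I))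
    + (∫ u in σ..ρ, f (u + T * Complex.I))
    + Complex.I * (∫ t in Set.Ioi T, f (ρ + t * Complex.I))

/-- A bound for the real and the imaginary parts of all `λ_l`. -/
def radius {n : ℕ} (lam : Fin n → ℂ) : ℝ := 1 + ∑ l, ‖lam l‖

/-- The Bessel function `J(x; ς, λ)` on the positive half line, as the Mellin-Barnes integral
`(2πi)⁻¹ ∫_C G(s; ς, λ) x^{-ns} ds`. The contour is vertical at infinity with real part
`-1 < 1/2 - 1/n`, so that the integral converges absolutely, and all the poles `λ_l - m` of the
integrand lie to its left. -/
def besselJPos {n : ℕ} (ς : Fin n → ℤˣ) (lam : Fin n → ℂ) (x : ℝ) : ℂ :=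
  1 / (2 * Real.pi * Complex.I) *
    contourIntegral (-1) (radius lam) (radius lam)
      fun s => G ς lam s * (x : ℂ) ^ (-((n : ℂ) * s))

/-- The Bessel function `J(z; ς, λ)` on the universal cover. -/
def besselJ {n : ℕ} (ς : Fin n → ℤˣ) (lam : Fin n → ℂ) : U → ℂ := continuation (besselJPos ς lam)

/-- The `H`-Bessel function `H^ε(z; λ) = J(z; ε, …, ε, λ)`. -/
def besselH {n : ℕ} (ε : ℤˣ) (lam : Fin n → ℂ) : U → ℂ := besselJ (fun _ => ε) lam

end FundamentalBessel

end

open FundamentalBessel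

open FundamentalBessel

namespace FundamentalBessel

/-! Bounds for the Gamma function on vertical lines. -/

/-! Replacing all signs by `ε` changes the integrand by the factor `e (-(ε/2) ∑ (s - λ_l))`, summed
over the `l` with `ς_l = -ε`. It splits into the constant `e (ε ∑ λ_l / 2)` and `exp (-π i ε n_{-ε}
s)`, and the latter is absorbed into `z ^ (-n s)` by rotating `z` through `ε π n_{-ε} / n`. So the
formula holds integrand by integrand (`mellinBarnesIntegrand_eq`), as soon as one integral
represents `J` on all of `U`.

The vertical contour does not provide it: with equal signs, `G` has only power decay at one end, and
a rotation can destroy convergence. The vertical ends are therefore folded onto horizontal rays to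
the left, where the Gamma factors decay faster than any exponential. The resulting loop integral is
entire in `w = log z` (`differentiable_besselLoop`) and agrees with `J` for real `w`
(`besselJPos_eq_besselLoop`); uniqueness of continuation identifies the two.

Folding and convergence both rest on `exists_norm_G_le`, the bound `A e^{B Re s} |Im s|^{-3/2}` for
every `B ≥ 0`. Instead of Stirling's formula, the proof uses reflection on the lines `Re s = 1/2`
and `Re s = 1`, near-monotonicity of `‖Γ‖` along horizontals, and the functional equation. This
loses at most `1/2` in the exponent `σ - 1/2`, and nothing when `2σ` is an integer. -/

theorem exp_le_norm_sin (s : ℂ) (hs : 1 ≤ |s.im|) :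
    Real.exp (Real.pi * |s.im|) / 4 ≤ ‖Complex.sin (Real.pi * s)‖ := by
  have key : ∀ y : ℝ, 1 ≤ y → Real.exp (Real.pi * y) / 4 ≤
      (Real.exp (Real.pi * y) - Real.exp (-(Real.pi * y))) / 2 := by
    intro y hy
    have h1 : 1 ≤ Real.pi * y := by nlinarith [Real.pi_gt_three]
    have h2 : 2 ≤ Real.exp (Real.pi * y) := by linarith [Real.add_one_le_exp (Real.pi * y)]
    have h3 : Real.exp (-(Real.pi * y)) ≤ 1 := Real.exp_le_one_iff.2 (by linarith)
    linarith
  have e1 : ‖Complex.exp (-(Real.pi * s) * Complex.I)‖ = Real.exp (Real.pi * s.im) := by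
    rw [Complex.norm_exp]; congr 1; simp
  have e2 : ‖Complex.exp ((Real.pi * s) * Complex.I)‖ = Real.exp (-(Real.pi * s.im)) := by
    rw [Complex.norm_exp]; congr 1; simp
  have e3 : ‖Complex.sin (Real.pi * s)‖ = ‖Complex.exp (-(Real.pi * s) * Complex.I)
      - Complex.exp ((Real.pi * s) * Complex.I)‖ / 2 := by
    rw [Complex.sin, norm_div, norm_mul]; simp
  rw [e3]
  rcases abs_cases s.im with ⟨h, _⟩ | ⟨h, _⟩
  · refine (key _ hs).trans ?_
    rw [h]
    have := norm_sub_norm_le (Complex.exp (-(Real.pi * s) * Complex.I))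
      (Complex.exp ((Real.pi * s) * Complex.I))
    rw [e1, e2] at this
    linarith
  · refine (key _ hs).trans ?_
    rw [h]
    have := norm_sub_norm_le (Complex.exp ((Real.pi * s) * Complex.I))
      (Complex.exp (-(Real.pi * s) * Complex.I))
    rw [e1, e2, norm_sub_rev] at this
    rw [mul_neg, neg_neg]
    linarith

theorem norm_Gamma_mul_Gamma_one_sub_le (s : ℂ) (hs : 1 ≤ |s.im|) :
    ‖Complex.Gamma s‖ * ‖Complex.Gamma (1 - s)‖ ≤ 16 * Real.exp (-(Real.pi * |s.im|)) := by
  have h := exp_le_norm_sin s hs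
  have hp := Real.exp_pos (Real.pi * |s.im|)
  rw [← norm_mul, Complex.Gamma_mul_Gamma_one_sub, norm_div, Complex.norm_real,
    Real.norm_of_nonneg Real.pi_pos.le, Real.exp_neg, div_le_iff₀ (by linarith)]
  calc Real.pi ≤ 4 := Real.pi_le_four
    _ = 16 * (Real.exp (Real.pi * |s.im|))⁻¹ * (Real.exp (Real.pi * |s.im|) / 4) := by
        field_simp; norm_num
    _ ≤ _ := by gcongr

theorem norm_Gamma_conj (s : ℂ) :
    ‖Complex.Gamma ((starRingEnd ℂ) s)‖ = ‖Complex.Gamma s‖ := by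
  rw [Complex.Gamma_conj, Complex.norm_conj]

/-- On this line `1 - s` is the conjugate of `s`, so reflection bounds `‖Γ s‖ ^ 2`. -/
theorem norm_Gamma_half_le (t : ℝ) (ht : 1 ≤ |t|) :
    ‖Complex.Gamma (1 / 2 + t * Complex.I)‖ ≤ 4 * Real.exp (-(Real.pi * |t| / 2)) := by
  have h := norm_Gamma_mul_Gamma_one_sub_le (1 / 2 + t * Complex.I) (by simpa using ht)
  have e1 : (1 : ℂ) - (1 / 2 + t * Complex.I) = (starRingEnd ℂ) (1 / 2 + t * Complex.I) := by
    apply Complex.ext <;> simp; norm_num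
  rw [e1, norm_Gamma_conj, ← sq] at h
  refine (pow_le_pow_iff_left₀ (norm_nonneg _) (by positivity) two_ne_zero).1 ?_
  refine h.trans (le_of_eq ?_)
  rw [mul_pow, ← Real.exp_nat_mul]
  norm_num
  ring_nf

theorem norm_Gamma_one_le (t : ℝ) (ht : 1 ≤ |t|) :
    ‖Complex.Gamma (1 + t * Complex.I)‖ ≤
      4 * (|t| ^ (1 / 2 : ℝ) * Real.exp (-(Real.pi * |t| / 2))) := by
  have h := norm_Gamma_mul_Gamma_one_sub_le (1 + t * Complex.I) (by simpa using ht)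
  have ht0 : (t : ℂ) ≠ 0 := by
    rintro h; norm_cast at h; subst h; norm_num at ht
  have e1 : (1 : ℂ) - (1 + t * Complex.I) = -(t * Complex.I) := by ring
  have e2 : (starRingEnd ℂ) (1 + t * Complex.I) = -(t * Complex.I) + 1 := by
    apply Complex.ext <;> simp
  have e3 := Complex.Gamma_add_one (-(t * Complex.I)) (by simpa using ht0)
  have e4 : ‖Complex.Gamma (1 + t * Complex.I)‖ = |t| * ‖Complex.Gamma (-(t * Complex.I))‖ := by
    rw [← norm_Gamma_conj, e2, e3, norm_mul]; simp
  rw [e1] at h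
  refine (pow_le_pow_iff_left₀ (norm_nonneg _) (by positivity) two_ne_zero).1 ?_
  calc ‖Complex.Gamma (1 + t * Complex.I)‖ ^ 2
      = |t| * (‖Complex.Gamma (1 + t * Complex.I)‖ * ‖Complex.Gamma (-(t * Complex.I))‖) := by
        rw [sq]; nth_rw 2 [e4]; ring
    _ ≤ |t| * (16 * Real.exp (-(Real.pi * |t|))) := by
        exact mul_le_mul_of_nonneg_left (by simpa using h) (abs_nonneg t)
    _ = _ := by
        rw [mul_pow, mul_pow, ← Real.exp_nat_mul, ← Real.sqrt_eq_rpow, Real.sq_sqrt (abs_nonneg t)]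
        push_cast
        rw [show (2 : ℝ) * -(Real.pi * |t| / 2) = -(Real.pi * |t|) by ring]
        ring

/-- Up to a constant, `‖Γ‖` increases along horizontal lines in the strip `1 ≤ Re s`. -/
theorem norm_Gamma_le_two_mul (s : ℂ) (hs : 1 ≤ s.re) (a : ℝ) (ha : 0 ≤ a) (ha1 : a ≤ 1) :
    ‖Complex.Gamma s‖ ≤ 2 * ‖Complex.Gamma (s + a)‖ := by
  rcases ha.eq_or_lt with rfl | ha
  · simp; linarith [norm_nonneg (Complex.Gamma s)]
  -- `Γ(s) Γ(a) = Γ(s + a) B(s, a)`, and `‖B(s, a)‖ ≤ 1 / a` because `|x ^ (s - 1)| ≤ 1` on `(0,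
  -- 1)`.
  have h := Complex.Gamma_mul_Gamma_eq_betaIntegral (s := s) (t := a)
    (by linarith) (by simpa using ha)
  have hint : IntervalIntegrable (fun x : ℝ => (1 - x) ^ (a - 1)) MeasureTheory.volume 0 1 := by
    have := (intervalIntegral.intervalIntegrable_rpow' (a := 0) (b := 1) (r := a - 1)
      (by linarith)).comp_sub_left 1
    simpa using this.symm
  have hb : ‖Complex.betaIntegral s a‖ ≤ 1 / a := by
    have e1 : ∫ x in (0 : ℝ)..1, (1 - x) ^ (a - 1) = 1 / a := by
      rw [intervalIntegral.integral_comp_sub_left (fun x : ℝ => x ^ (a - 1)) 1,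
        integral_rpow (Or.inl (by linarith))]
      simp [ha.ne']
    rw [← e1]
    refine intervalIntegral.norm_integral_le_of_norm_le zero_le_one ?_ hint
    have h1 : ∀ᵐ x : ℝ, x ≠ 1 := by
      simp [MeasureTheory.ae_iff]
    filter_upwards [h1] with x hx1 hx
    have hx0 : 0 < x := hx.1
    have hx2 : 0 < 1 - x := sub_pos.2 (lt_of_le_of_ne hx.2 hx1)
    rw [norm_mul, Complex.norm_cpow_eq_rpow_re_of_pos hx0,
      show (1 : ℂ) - x = ((1 - x : ℝ) : ℂ) by push_cast; rfl,
      Complex.norm_cpow_eq_rpow_re_of_pos hx2]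
    have : x ^ (s - 1).re ≤ 1 := Real.rpow_le_one hx0.le hx.2 (by simpa using hs)
    calc _ ≤ 1 * (1 - x) ^ ((a : ℂ) - 1).re := by gcongr
      _ = _ := by simp
  have hG : ‖Complex.Gamma a‖ = Real.Gamma a := by
    rw [Complex.Gamma_ofReal, Complex.norm_real, Real.norm_of_nonneg (Real.Gamma_pos_of_pos ha).le]
  -- `(a + 1) a Γ(a) = Γ(a + 2) ≥ Γ(2) = 1` and `a + 1 ≤ 2`.
  have h2 : 1 ≤ 2 * (a * Real.Gamma a) := by
    have h3 : Real.Gamma 2 ≤ Real.Gamma (a + 1 + 1) :=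
      Real.Gamma_strictMonoOn_Ici.monotoneOn (by simp) (by simp; linarith) (by linarith)
    rw [Real.Gamma_two, Real.Gamma_add_one (by linarith), Real.Gamma_add_one ha.ne'] at h3
    have : 0 < a * Real.Gamma a := mul_pos ha (Real.Gamma_pos_of_pos ha)
    nlinarith
  have h4 : ‖Complex.Gamma s‖ * Real.Gamma a ≤ ‖Complex.Gamma (s + a)‖ * (1 / a) := by
    rw [← hG, ← norm_mul, h, norm_mul]
    gcongr
  rw [mul_one_div, le_div_iff₀ ha] at h4
  nlinarith [norm_nonneg (Complex.Gamma s)]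

/-- The exponent in the bound for the Gamma function on the line `Re s = σ`. -/
noncomputable def gammaExponent (σ : ℝ) : ℝ := (⌈2 * σ⌉ - 1) / 2

theorem gammaExponent_add_one (σ : ℝ) : gammaExponent (σ + 1) = gammaExponent σ + 1 := by
  have : ⌈2 * (σ + 1)⌉ = ⌈2 * σ⌉ + 2 := by
    rw [show 2 * (σ + 1) = 2 * σ + (2 : ℤ) by push_cast; ring, Int.ceil_add_intCast]
  rw [gammaExponent, gammaExponent, this]
  push_cast
  ring

theorem gammaExponent_le (σ : ℝ) : gammaExponent σ ≤ σ := by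
  have := Int.ceil_lt_add_one (2 * σ)
  rw [gammaExponent]
  linarith

theorem le_gammaExponent (σ : ℝ) : σ - 1 ≤ gammaExponent σ := by
  have := Int.le_ceil (2 * σ)
  rw [gammaExponent]
  linarith

theorem gammaExponent_mono {σ τ : ℝ} (h : σ ≤ τ) : gammaExponent σ ≤ gammaExponent τ := by
  have : (⌈2 * σ⌉ : ℝ) ≤ ⌈2 * τ⌉ := by exact_mod_cast Int.ceil_mono (by linarith)
  rw [gammaExponent, gammaExponent]
  linarith

theorem norm_Gamma_add_one (s : ℂ) (hs : s ≠ 0) :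
    ‖Complex.Gamma (s + 1)‖ = ‖s‖ * ‖Complex.Gamma s‖ := by
  rw [Complex.Gamma_add_one s hs, norm_mul]

/-- Moving right to the next abscissa `3/2` or `2` costs a factor 2; one functional equation then
leads back to the line `1/2` or `1`. -/
theorem norm_Gamma_le_of_mem_Ioc (s : ℂ) (h1 : 1 < s.re) (h2 : s.re ≤ 2) (ht : 1 ≤ |s.im|) :
    ‖Complex.Gamma s‖ ≤
      16 * (|s.im| ^ gammaExponent s.re * Real.exp (-(Real.pi * |s.im| / 2))) := by
  have ht0 : s.im ≠ 0 := by intro h; rw [h] at ht; norm_num at ht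
  rcases le_or_gt s.re (3 / 2) with h3 | h3
  · have hexp : gammaExponent s.re = 1 := by
      have : ⌈2 * s.re⌉ = 3 := by
        rw [Int.ceil_eq_iff]; push_cast; constructor <;> linarith
      rw [gammaExponent, this]; norm_num
    have h4 := norm_Gamma_le_two_mul s h1.le (3 / 2 - s.re) (by linarith) (by linarith)
    have e1 : s + ((3 / 2 - s.re : ℝ) : ℂ) = (1 / 2 + s.im * Complex.I) + 1 := by
      apply Complex.ext <;> simp; norm_num
    have h5 : ‖(1 / 2 + s.im * Complex.I : ℂ)‖ ≤ 2 * |s.im| := by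
      refine (norm_add_le _ _).trans ?_
      simp; linarith
    rw [e1, norm_Gamma_add_one _ (fun h => ht0 (by simpa using congrArg Complex.im h))] at h4
    rw [hexp, Real.rpow_one]
    have h6 := norm_Gamma_half_le s.im ht
    calc _ ≤ _ := h4
      _ ≤ 2 * ((2 * |s.im|) * (4 * Real.exp (-(Real.pi * |s.im| / 2)))) := by gcongr
      _ = _ := by ring
  · have hexp : gammaExponent s.re = 1 + 1 / 2 := by
      have : ⌈2 * s.re⌉ = 4 := by
        rw [Int.ceil_eq_iff]; push_cast; constructor <;> linarith
      rw [gammaExponent, this]; norm_num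
    have h4 := norm_Gamma_le_two_mul s h1.le (2 - s.re) (by linarith) (by linarith)
    have e1 : s + ((2 - s.re : ℝ) : ℂ) = (1 + s.im * Complex.I) + 1 := by
      apply Complex.ext <;> simp; norm_num
    have h5 : ‖(1 + s.im * Complex.I : ℂ)‖ ≤ 2 * |s.im| := by
      refine (norm_add_le _ _).trans ?_
      simp; linarith
    rw [e1, norm_Gamma_add_one _ (fun h => ht0 (by simpa using congrArg Complex.im h))] at h4
    rw [hexp, Real.rpow_add (by linarith), Real.rpow_one]
    have h6 := norm_Gamma_one_le s.im ht
    calc _ ≤ _ := h4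
      _ ≤ 2 * ((2 * |s.im|) *
          (4 * (|s.im| ^ (1 / 2 : ℝ) * Real.exp (-(Real.pi * |s.im| / 2))))) := by gcongr
      _ = _ := by ring

/-- A step to the left divides by `|s| ≥ |Im s|`, which lowers the exponent by 1 and keeps the
constant 16, however far left `s` lies. -/
theorem norm_Gamma_le_of_re_le_two (m : ℕ) (s : ℂ) (h1 : 1 - m < s.re) (h2 : s.re ≤ 2)
    (ht : 1 ≤ |s.im|) : ‖Complex.Gamma s‖ ≤
      16 * (|s.im| ^ gammaExponent s.re * Real.exp (-(Real.pi * |s.im| / 2))) := by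
  induction m generalizing s with
  | zero => exact norm_Gamma_le_of_mem_Ioc s (by simpa using h1) h2 ht
  | succ m ih =>
    rcases lt_or_ge 1 s.re with h3 | h3
    · exact norm_Gamma_le_of_mem_Ioc s h3 h2 ht
    have h4 := ih (s + 1) (by push_cast at h1; simp; linarith) (by simp; linarith) (by simpa using ht)
    have hs : s ≠ 0 := by rintro rfl; norm_num at ht
    have hpos : 0 < |s.im| := by linarith
    rw [norm_Gamma_add_one s hs, Complex.add_re, Complex.one_re, gammaExponent_add_one,
      Complex.add_im, Complex.one_im, add_zero, Real.rpow_add hpos, Real.rpow_one] at h4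
    have h5 := Complex.abs_im_le_norm s
    refine le_of_mul_le_mul_left ?_ hpos
    calc |s.im| * ‖Complex.Gamma s‖ ≤ ‖s‖ * ‖Complex.Gamma s‖ := by gcongr
      _ ≤ _ := h4
      _ = _ := by ring

theorem exists_norm_Gamma_le (b : ℕ) : ∃ C : ℝ, 0 < C ∧ ∀ s : ℂ, s.re ≤ b → 1 ≤ |s.im| →
    ‖Complex.Gamma s‖ ≤
      C * (|s.im| ^ gammaExponent s.re * Real.exp (-(Real.pi * |s.im| / 2))) := by
  induction b with
  | zero =>
    refine ⟨16, by norm_num, fun s hs ht => ?_⟩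
    obtain ⟨m, hm⟩ := exists_nat_gt (1 - s.re)
    exact norm_Gamma_le_of_re_le_two m s (by linarith) (by push_cast at hs; linarith) ht
  | succ b ih =>
    obtain ⟨C, hC, h⟩ := ih
    refine ⟨16 + C * (b + 2), by positivity, fun s hs ht => ?_⟩
    have hpos : 0 < |s.im| := by linarith
    have hX : 0 < |s.im| ^ gammaExponent s.re * Real.exp (-(Real.pi * |s.im| / 2)) := by positivity
    rcases le_or_gt s.re 2 with h2 | h2
    · obtain ⟨m, hm⟩ := exists_nat_gt (1 - s.re)
      refine (norm_Gamma_le_of_re_le_two m s (by linarith) h2 ht).trans ?_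
      gcongr
      have : 0 ≤ C * (b + 2) := by positivity
      linarith
    · have h3 := h (s - 1) (by push_cast at hs; simp; linarith) (by simpa using ht)
      have hne : s - 1 ≠ 0 := by
        intro h; have := congrArg Complex.im h; simp at this; rw [this] at hpos; simp at hpos
      have h4 := norm_Gamma_add_one (s - 1) hne
      have h5 : ‖s - 1‖ ≤ (b + 2) * |s.im| := by
        refine (Complex.norm_le_abs_re_add_abs_im _).trans ?_
        have : |(s - 1).re| ≤ (b : ℝ) + 1 := by
          push_cast at hs
          rw [abs_of_nonneg (by simp; linarith)]; simp; linarith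
        simp only [Complex.sub_im, Complex.one_im, sub_zero]
        nlinarith
      have h6 := gammaExponent_add_one (s - 1).re
      simp only [Complex.sub_re, Complex.one_re, sub_add_cancel, Complex.sub_im, Complex.one_im,
        sub_zero] at h3 h4 h6
      rw [h4, h6, Real.rpow_add hpos, Real.rpow_one]
      calc _ ≤ ((b + 2) * |s.im|) * (C * (|s.im| ^ gammaExponent (s.re - 1) *
              Real.exp (-(Real.pi * |s.im| / 2)))) := by gcongr
        _ = C * (b + 2) * (|s.im| ^ gammaExponent (s.re - 1) * |s.im| *
              Real.exp (-(Real.pi * |s.im| / 2))) := by ring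
        _ ≤ _ := by gcongr; linarith

end FundamentalBessel

namespace FundamentalBessel

/-! Bounds for the product of Gamma factors. -/

theorem one_le_radius {n : ℕ} (lam : Fin n → ℂ) : 1 ≤ radius lam := by
  have : 0 ≤ ∑ l, ‖lam l‖ := Finset.sum_nonneg fun l _ => norm_nonneg _
  rw [radius]
  linarith

theorem norm_add_one_le_radius {n : ℕ} (lam : Fin n → ℂ) (l : Fin n) :
    ‖lam l‖ + 1 ≤ radius lam := by
  have := Finset.single_le_sum (f := fun l => ‖lam l‖) (fun l _ => norm_nonneg _)
    (Finset.mem_univ l)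
  rw [radius]
  linarith

theorem norm_e_sign_mul (u : ℤˣ) (z : ℂ) :
    ‖e (((u : ℤ) : ℂ) * z / 4)‖ = Real.exp (-(Real.pi * ((u : ℤ) * z.im) / 2)) := by
  rw [e, Complex.norm_exp]
  congr 1
  have : (2 * Real.pi * Complex.I * (((u : ℤ) : ℂ) * z / 4)) =
      ((Real.pi * (u : ℤ) / 2 : ℝ) : ℂ) * (Complex.I * z) := by push_cast; ring
  rw [this, Complex.re_ofReal_mul]
  simp
  ring

/-- The growth allowed here is exactly the exponential decay of `Γ`, so only a power of `|Im s|`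
survives in each factor of `G`. -/
theorem norm_e_sign_mul_le (u : ℤˣ) (z : ℂ) :
    ‖e (((u : ℤ) : ℂ) * z / 4)‖ ≤ Real.exp (Real.pi * |z.im| / 2) := by
  rw [norm_e_sign_mul]
  apply Real.exp_le_exp.2
  have h : -((u : ℤ) * z.im) ≤ |z.im| := by
    rcases Int.units_eq_one_or u with rfl | rfl
    · simpa using neg_le_abs z.im
    · simpa using le_abs_self z.im
  nlinarith [Real.pi_pos]

theorem rpow_le_mul_rpow {t v K p P : ℝ} (ht : 0 < t) (hK : 1 ≤ K) (h1 : t / K ≤ v)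
    (h2 : v ≤ K * t) (hp : |p| ≤ P) : v ^ p ≤ K ^ P * t ^ p := by
  have hK0 : 0 < K := by linarith
  have hv : 0 < v := (div_pos ht hK0).trans_le h1
  rcases le_total 0 p with h | h
  · rw [abs_of_nonneg h] at hp
    calc v ^ p ≤ (K * t) ^ p := Real.rpow_le_rpow hv.le h2 h
      _ = K ^ p * t ^ p := Real.mul_rpow hK0.le ht.le
      _ ≤ _ := by gcongr
  · rw [abs_of_nonpos h] at hp
    calc v ^ p ≤ (t / K) ^ p := Real.rpow_le_rpow_of_nonpos (div_pos ht hK0) h1 h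
      _ = K ^ (-p) * t ^ p := by
        rw [Real.div_rpow ht.le hK0.le, Real.rpow_neg hK0.le]; ring
      _ ≤ _ := by gcongr

theorem exists_norm_factor_le (u : ℤˣ) {c : ℂ} {R : ℝ} (hc : ‖c‖ + 1 ≤ R) :
    ∃ C : ℝ, 0 < C ∧ ∀ s : ℂ, -2 ≤ s.re → s.re ≤ -1 → R ≤ |s.im| →
      ‖Complex.Gamma (s - c) * e (((u : ℤ) : ℂ) * (s - c) / 4)‖ ≤
        C * |s.im| ^ gammaExponent (s.re - c.re) := by
  obtain ⟨b, hb⟩ := exists_nat_ge ‖c‖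
  obtain ⟨C, hC, h⟩ := exists_norm_Gamma_le b
  have hR : 1 ≤ R := by linarith [norm_nonneg c]
  -- `2 R` compares `|Im (s - c)|` with `|Im s|` in both directions; `R + 3` bounds the exponent,
  -- which is why `Re s` is kept in a strip.
  refine ⟨C * (2 * R) ^ (R + 3), by positivity, fun s h1 h2 h3 => ?_⟩
  have hre := abs_le.1 (Complex.abs_re_le_norm c)
  have him := Complex.abs_im_le_norm c
  have hv1 : |s.im| - ‖c‖ ≤ |(s - c).im| := by
    rw [Complex.sub_im]; linarith [abs_sub_abs_le_abs_sub s.im c.im]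
  have hv2 : |(s - c).im| ≤ |s.im| + ‖c‖ := by
    rw [Complex.sub_im]; linarith [abs_sub s.im c.im]
  have h4 := h (s - c) (by rw [Complex.sub_re]; linarith) (by linarith)
  rw [Complex.sub_re] at h4
  have hP : |gammaExponent (s.re - c.re)| ≤ R + 3 := by
    have := gammaExponent_le (s.re - c.re)
    have := le_gammaExponent (s.re - c.re)
    rw [abs_le]
    constructor <;> linarith [hre.1, hre.2]
  have ht : 0 < |s.im| := by linarith
  have h5 : |(s - c).im| ^ gammaExponent (s.re - c.re) ≤
      (2 * R) ^ (R + 3) * |s.im| ^ gammaExponent (s.re - c.re) := by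
    refine rpow_le_mul_rpow ht (by linarith) ?_ (by nlinarith) hP
    rw [div_le_iff₀ (by linarith)]
    nlinarith
  rw [norm_mul]
  calc _ ≤ (C * (|(s - c).im| ^ gammaExponent (s.re - c.re) *
        Real.exp (-(Real.pi * |(s - c).im| / 2)))) * Real.exp (Real.pi * |(s - c).im| / 2) := by
        gcongr
        exact norm_e_sign_mul_le _ _
    _ = C * |(s - c).im| ^ gammaExponent (s.re - c.re) := by
        rw [Real.exp_neg]; field_simp
    _ ≤ C * ((2 * R) ^ (R + 3) * |s.im| ^ gammaExponent (s.re - c.re)) := by gcongr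
    _ = _ := by ring

/-- For `n ≥ 2` the crude bound `gammaExponent σ ≤ σ` gives `n σ ≤ -2`, the `λ_l` summing to zero.
For `n = 1`, where `λ = 0`, the exact value `-3/2` at `σ = -1` is needed. -/
theorem sum_gammaExponent_le {n : ℕ} (hn : 0 < n) (lam : Fin n → ℂ) (hlam : ∑ l, lam l = 0)
    {σ : ℝ} (hσ : σ ≤ -1) : ∑ l, gammaExponent (σ - (lam l).re) ≤ -(3 / 2) := by
  rcases (Nat.succ_le_of_lt hn).eq_or_lt with h1 | h2
  · obtain rfl : n = 1 := h1.symm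
    rw [Fin.sum_univ_one] at hlam
    rw [Fin.sum_univ_one, hlam]
    refine (gammaExponent_mono (τ := -1) (by simpa using hσ)).trans (le_of_eq ?_)
    have : ⌈2 * (-1 : ℝ)⌉ = -2 := by
      rw [show 2 * (-1 : ℝ) = ((-2 : ℤ) : ℝ) by norm_num, Int.ceil_intCast]
    rw [gammaExponent, this]; norm_num
  · have h3 : ∑ l, (lam l).re = 0 := by rw [← Complex.re_sum, hlam, Complex.zero_re]
    have h4 : ∑ l, gammaExponent (σ - (lam l).re) ≤ ∑ l, (σ - (lam l).re) :=
      Finset.sum_le_sum fun l _ => gammaExponent_le _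
    rw [Finset.sum_sub_distrib, h3] at h4
    simp only [Finset.sum_const, Finset.card_univ, Fintype.card_fin, nsmul_eq_mul, sub_zero] at h4
    have : (2 : ℝ) ≤ n := by exact_mod_cast h2
    nlinarith

theorem exists_norm_G_le_of_strip {n : ℕ} (hn : 0 < n) (ς : Fin n → ℤˣ) (lam : Fin n → ℂ)
    (hlam : ∑ l, lam l = 0) :
    ∃ A : ℝ, 0 < A ∧ ∀ s : ℂ, -2 ≤ s.re → s.re ≤ -1 → radius lam ≤ |s.im| →
      ‖G ς lam s‖ ≤ A * |s.im| ^ (-(3 / 2) : ℝ) := by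
  choose C hC h using fun l => exists_norm_factor_le (ς l) (norm_add_one_le_radius lam l)
  refine ⟨∏ l, C l, Finset.prod_pos fun l _ => hC l, fun s h1 h2 h3 => ?_⟩
  have ht : 1 ≤ |s.im| := (one_le_radius lam).trans h3
  have hC0 : 0 < ∏ l, C l := Finset.prod_pos fun l _ => hC l
  rw [G, norm_prod]
  calc _ ≤ ∏ l, C l * |s.im| ^ gammaExponent (s.re - (lam l).re) :=
        Finset.prod_le_prod (fun l _ => norm_nonneg _) fun l _ => h l s h1 h2 h3
    _ = (∏ l, C l) * |s.im| ^ ∑ l, gammaExponent (s.re - (lam l).re) := by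
        rw [Finset.prod_mul_distrib, Real.rpow_sum_of_pos (by linarith)]
    _ ≤ _ := by
        gcongr
        exact sum_gammaExponent_le hn lam hlam h2

theorem norm_G_add_one {n : ℕ} (ς : Fin n → ℤˣ) (lam : Fin n → ℂ) (s : ℂ)
    (hs : ∀ l, s - lam l ≠ 0) :
    ‖G ς lam (s + 1)‖ = (∏ l, ‖s - lam l‖) * ‖G ς lam s‖ := by
  rw [G, G, norm_prod, norm_prod, ← Finset.prod_mul_distrib]
  refine Finset.prod_congr rfl fun l _ => ?_
  rw [norm_mul, norm_mul, add_sub_right_comm, norm_Gamma_add_one _ (hs l), norm_e_sign_mul,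
    norm_e_sign_mul, Complex.add_im, Complex.one_im, add_zero, mul_assoc]

theorem one_le_abs_im_sub {n : ℕ} (lam : Fin n → ℂ) {s : ℂ} (hs : radius lam ≤ |s.im|)
    (l : Fin n) : 1 ≤ |(s - lam l).im| := by
  have h1 := Complex.abs_im_le_norm (lam l)
  have h2 := norm_add_one_le_radius lam l
  rw [Complex.sub_im]
  linarith [abs_sub_abs_le_abs_sub s.im (lam l).im]

theorem sub_ne_zero_of_radius_le {n : ℕ} (lam : Fin n → ℂ) {s : ℂ} (hs : radius lam ≤ |s.im|)
    (l : Fin n) : s - lam l ≠ 0 := by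
  intro h
  have := one_le_abs_im_sub lam hs l
  rw [h] at this
  norm_num at this

/-- Each step left of the strip divides `‖G‖` by `∏ ‖s - λ_l‖ ≥ 1`. -/
theorem exists_norm_G_le_of_re_le {n : ℕ} (hn : 0 < n) (ς : Fin n → ℤˣ) (lam : Fin n → ℂ)
    (hlam : ∑ l, lam l = 0) :
    ∃ A : ℝ, 0 < A ∧ ∀ s : ℂ, s.re ≤ -1 → radius lam ≤ |s.im| →
      ‖G ς lam s‖ ≤ A * |s.im| ^ (-(3 / 2) : ℝ) := by
  obtain ⟨A, hA, h⟩ := exists_norm_G_le_of_strip hn ς lam hlam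
  refine ⟨A, hA, ?_⟩
  have key : ∀ (m : ℕ) (s : ℂ), -2 - m ≤ s.re → s.re ≤ -1 → radius lam ≤ |s.im| →
      ‖G ς lam s‖ ≤ A * |s.im| ^ (-(3 / 2) : ℝ) := by
    intro m
    induction m with
    | zero => exact fun s h1 => h s (by simpa using h1)
    | succ m ih =>
      intro s h1 h2 h3
      rcases le_or_gt (-2) s.re with h4 | h4
      · exact h s h4 h2 h3
      have h5 := ih (s + 1) (by push_cast at h1; simp; linarith) (by simp; linarith) (by simpa using h3)
      rw [norm_G_add_one ς lam s (sub_ne_zero_of_radius_le lam h3), Complex.add_im, Complex.one_im,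
        add_zero] at h5
      refine le_trans (le_mul_of_one_le_left (norm_nonneg _) ?_) h5
      calc (1 : ℝ) = ∏ _l : Fin n, (1 : ℝ) := by simp
        _ ≤ _ := Finset.prod_le_prod (fun _ _ => zero_le_one) fun l _ =>
          (one_le_abs_im_sub lam h3 l).trans (Complex.abs_im_le_norm _)
  intro s h1 h2
  obtain ⟨m, hm⟩ := exists_nat_ge (-2 - s.re)
  exact key m s (by linarith) h1 h2

/-- To the left of the poles, `G` decays faster than any exponential, uniformly with the decay on
vertical lines. -/
theorem exists_norm_G_le {n : ℕ} (hn : 0 < n) (ς : Fin n → ℤˣ) (lam : Fin n → ℂ)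
    (hlam : ∑ l, lam l = 0) {B : ℝ} (hB : 0 ≤ B) :
    ∃ A : ℝ, 0 < A ∧ ∀ s : ℂ, s.re ≤ -1 → radius lam ≤ |s.im| →
      ‖G ς lam s‖ ≤ A * (Real.exp (B * s.re) * |s.im| ^ (-(3 / 2) : ℝ)) := by
  obtain ⟨A, hA, h⟩ := exists_norm_G_le_of_re_le hn ς lam hlam
  -- Beyond `Re s = -N` every `‖s - λ_l‖` is at least `e^B`, so each step left gains `e^B`; the
  -- constant `e^{BN}` pays for `-N ≤ Re s ≤ -1`.
  obtain ⟨N, hN⟩ := exists_nat_ge (Real.exp B + radius lam + 2)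
  have hR := one_le_radius lam
  have hB1 : 1 ≤ Real.exp B := Real.one_le_exp hB
  refine ⟨A * Real.exp (B * N), by positivity, ?_⟩
  have key : ∀ (m : ℕ) (s : ℂ), -N - m ≤ s.re → s.re ≤ -1 → radius lam ≤ |s.im| →
      ‖G ς lam s‖ ≤ A * Real.exp (B * N) * (Real.exp (B * s.re) * |s.im| ^ (-(3 / 2) : ℝ)) := by
    have base : ∀ s : ℂ, -N ≤ s.re → s.re ≤ -1 → radius lam ≤ |s.im| →
        ‖G ς lam s‖ ≤
          A * Real.exp (B * N) * (Real.exp (B * s.re) * |s.im| ^ (-(3 / 2) : ℝ)) := by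
      intro s h1 h2 h3
      refine (h s h2 h3).trans ?_
      rw [show A * Real.exp (B * N) * (Real.exp (B * s.re) * |s.im| ^ (-(3 / 2) : ℝ)) =
        A * (Real.exp (B * N + B * s.re) * |s.im| ^ (-(3 / 2) : ℝ)) by rw [Real.exp_add]; ring]
      gcongr
      refine le_mul_of_one_le_left (by positivity) (Real.one_le_exp ?_)
      nlinarith
    intro m
    induction m with
    | zero => exact fun s h1 => base s (by simpa using h1)
    | succ m ih =>
      intro s h1 h2 h3
      rcases le_or_gt (-(N : ℝ)) s.re with h4 | h4
      · exact base s h4 h2 h3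
      have h5 := ih (s + 1) (by push_cast at h1; simp; linarith) (by simp; linarith)
        (by simpa using h3)
      rw [norm_G_add_one ς lam s (sub_ne_zero_of_radius_le lam h3), Complex.add_im, Complex.one_im,
        add_zero, Complex.add_re, Complex.one_re, mul_add, mul_one, Real.exp_add] at h5
      have h6 : Real.exp B ≤ ∏ l, ‖s - lam l‖ := by
        calc Real.exp B ≤ Real.exp B ^ n := le_self_pow₀ hB1 hn.ne'
          _ = ∏ _l : Fin n, Real.exp B := by simp
          _ ≤ _ := Finset.prod_le_prod (fun l _ => (Real.exp_pos _).le) fun l _ => by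
            have h7 := norm_add_one_le_radius lam l
            have h8 := norm_sub_norm_le s (lam l)
            have h9 := (neg_le_abs s.re).trans (Complex.abs_re_le_norm s)
            linarith
      refine le_of_mul_le_mul_left (le_trans ?_ h5 |>.trans (le_of_eq ?_)) (Real.exp_pos B)
      · gcongr
      · ring
  intro s h1 h2
  obtain ⟨m, hm⟩ := exists_nat_ge (-N - s.re)
  exact key m s (by linarith) h1 h2

theorem differentiableAt_G {n : ℕ} (ς : Fin n → ℤˣ) (lam : Fin n → ℂ) {s : ℂ}
    (hs : radius lam ≤ |s.im| ∨ radius lam ≤ s.re) : DifferentiableAt ℂ (G ς lam) s := by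
  have key : ∀ l, DifferentiableAt ℂ (fun s : ℂ => Complex.Gamma (s - lam l) *
      e (((ς l : ℤ) : ℂ) * (s - lam l) / 4)) s := by
    intro l
    refine DifferentiableAt.mul ?_ (by unfold e; fun_prop)
    refine DifferentiableAt.comp (f := fun s : ℂ => s - lam l) s
      (Complex.differentiableAt_Gamma _ fun m hm => ?_) (by fun_prop)
    rcases hs with hs | hs
    · have := one_le_abs_im_sub lam hs l
      rw [hm] at this
      norm_num at this
    · have h1 := congrArg Complex.re hm
      have h2 := (abs_le.1 (Complex.abs_re_le_norm (lam l))).2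
      have h3 := norm_add_one_le_radius lam l
      simp at h1
      have : (0 : ℝ) ≤ m := by positivity
      linarith
  have := DifferentiableAt.fun_finsetProd (u := Finset.univ) fun l _ => key l
  exact this

end FundamentalBessel

namespace FundamentalBessel

open MeasureTheory Filter Topology

/-! Contour integrals. -/

/-- If the Laplace transform of `g` with phase `h` converges absolutely for all exponents, then it
is an entire function. -/
theorem differentiable_integral_mul_exp {α : Type*} [MeasurableSpace α] {μ : Measure α}
    {g h : α → ℂ} (hg : AEStronglyMeasurable g μ) (hh : AEStronglyMeasurable h μ)
    (hint : ∀ B : ℝ, Integrable (fun a => ‖g a‖ * Real.exp (B * ‖h a‖)) μ) :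
    Differentiable ℂ fun w : ℂ => ∫ a, g a * Complex.exp (h a * w) ∂μ := by
  have hm : ∀ w : ℂ, AEStronglyMeasurable (fun a => g a * Complex.exp (h a * w)) μ := fun w =>
    hg.mul (Complex.continuous_exp.comp_aestronglyMeasurable (hh.mul_const w))
  have hnorm : ∀ (z w : ℂ), ‖Complex.exp (z * w)‖ ≤ Real.exp (‖w‖ * ‖z‖) := by
    intro z w
    rw [mul_comm ‖w‖, ← norm_mul]
    exact Complex.norm_exp_le_exp_norm _
  intro w₀
  refine (hasDerivAt_integral_of_dominated_loc_of_deriv_le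
    (F' := fun w a => g a * (Complex.exp (h a * w) * h a))
    -- One unit is for the ball around `w₀`, the other absorbs the derivative's factor through `‖h
    -- a‖ ≤ e^{‖h a‖}`.
    (bound := fun a => ‖g a‖ * Real.exp ((‖w₀‖ + 2) * ‖h a‖))
    (Metric.ball_mem_nhds w₀ one_pos) (Eventually.of_forall hm) ?_ ?_ ?_ (hint _) ?_).2
    |>.differentiableAt
  · refine (hint ‖w₀‖).mono' (hm _) (ae_of_all _ fun a => ?_)
    rw [norm_mul]
    gcongr
    exact hnorm _ _
  · exact hg.mul ((Complex.continuous_exp.comp_aestronglyMeasurable (hh.mul_const w₀)).mul hh)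
  · refine ae_of_all _ fun a w hw => ?_
    have h1 : ‖w‖ ≤ ‖w₀‖ + 1 := by
      have := norm_le_norm_add_norm_sub' w w₀
      rw [Metric.mem_ball, dist_eq_norm] at hw
      linarith
    rw [norm_mul, norm_mul]
    gcongr
    calc ‖Complex.exp (h a * w)‖ * ‖h a‖
        ≤ Real.exp ((‖w₀‖ + 1) * ‖h a‖) * Real.exp ‖h a‖ := by
          gcongr
          · refine (hnorm _ _).trans ?_
            gcongr
          · linarith [Real.add_one_le_exp ‖h a‖]
      _ = _ := by rw [← Real.exp_add]; congr 1; ring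
  · refine ae_of_all _ fun a w _ => ?_
    refine HasDerivAt.const_mul (g a) ?_
    simpa using ((hasDerivAt_id w).const_mul (h a)).cexp

theorem differentiable_intervalIntegral_mul_exp {g h : ℝ → ℂ} (hg : Continuous g)
    (hh : Continuous h) (a b : ℝ) :
    Differentiable ℂ fun w : ℂ => ∫ u in a..b, g u * Complex.exp (h u * w) := by
  have key : ∀ a b : ℝ, Differentiable ℂ fun w : ℂ =>
      ∫ u in Set.Ioc a b, g u * Complex.exp (h u * w) := by
    intro a b
    refine differentiable_integral_mul_exp hg.aestronglyMeasurable hh.aestronglyMeasurable ?_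
    intro B
    have : Continuous fun u => ‖g u‖ * Real.exp (B * ‖h u‖) := by fun_prop
    exact (this.integrableOn_Icc (a := a) (b := b)).mono_set Set.Ioc_subset_Icc_self
  simp only [intervalIntegral]
  exact (key a b).sub (key b a)

/-- Cauchy's theorem for the quadrant `Re s ≤ -1`, `Im s ≥ R`. -/
theorem integral_quadrant_eq_zero {f : ℂ → ℂ} {R A : ℝ} (hR : 1 ≤ R)
    (hf : ∀ s : ℂ, R ≤ s.im → DifferentiableAt ℂ f s)
    (hb : ∀ s : ℂ, s.re ≤ -1 → R ≤ s.im → ‖f s‖ ≤ A * (Real.exp s.re * s.im ^ (-(3 / 2) : ℝ))) :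
    (∫ u in Set.Iic (-1 : ℝ), f (u + R * Complex.I)) +
      Complex.I * (∫ t in Set.Ioi R, f (((-1 : ℝ) : ℂ) + t * Complex.I)) = 0 := by
  have hR0 : 0 < R := by linarith
  have hA : 0 ≤ A := by
    have := (norm_nonneg _).trans (hb (-1 + R * Complex.I) (by simp) (by simp))
    refine nonneg_of_mul_nonneg_left this ?_
    have : 0 < ((-1 : ℂ) + R * Complex.I).im := by simpa using hR0
    positivity
  have hpow : ∀ t : ℝ, 1 ≤ t → t ^ (-(3 / 2) : ℝ) ≤ 1 := fun t ht =>
    Real.rpow_le_one_of_one_le_of_nonpos ht (by norm_num)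
  have i1 : IntegrableOn (fun u : ℝ => f (u + R * Complex.I)) (Set.Iic (-1)) := by
    refine Integrable.mono' ((integrableOn_exp_Iic (-1)).const_mul A) ?_ ?_
    · have : Continuous fun u : ℝ => f (u + R * Complex.I) := by
        refine continuous_iff_continuousAt.2 fun u => ?_
        exact ContinuousAt.comp (f := fun u : ℝ => (u + R * Complex.I : ℂ)) (hf _ (by simp)).continuousAt (by fun_prop)
      exact this.aestronglyMeasurable
    · refine (ae_restrict_iff' measurableSet_Iic).2 (ae_of_all _ fun u hu => ?_)
      refine (hb _ (by simpa using hu) (by simp)).trans ?_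
      gcongr
      simp only [Complex.add_re, Complex.ofReal_re, Complex.mul_re, Complex.I_re, mul_zero,
        Complex.ofReal_im, Complex.I_im, mul_one, sub_self, add_zero, Complex.add_im,
        Complex.mul_im, zero_add]
      exact mul_le_of_le_one_right (Real.exp_pos _).le (hpow R hR)
  have i2 : IntegrableOn (fun t : ℝ => f (((-1 : ℝ) : ℂ) + t * Complex.I)) (Set.Ioi R) := by
    refine Integrable.mono'
      ((integrableOn_Ioi_rpow_of_lt (a := -(3 / 2)) (by norm_num) hR0).const_mul A) ?_ ?_
    · refine ContinuousOn.aestronglyMeasurable (fun t ht => ?_) measurableSet_Ioi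
      refine ContinuousAt.continuousWithinAt ?_
      exact ContinuousAt.comp (f := fun t : ℝ => (((-1 : ℝ) : ℂ) + t * Complex.I : ℂ))
        (hf _ (by simpa using (le_of_lt ht))).continuousAt (by fun_prop)
    · refine (ae_restrict_iff' measurableSet_Ioi).2 (ae_of_all _ fun t ht => ?_)
      have ht' : R ≤ t := le_of_lt ht
      refine (hb _ (by simp) (by simpa using ht')).trans ?_
      gcongr
      have : 0 ≤ t ^ (-(3 / 2) : ℝ) := Real.rpow_nonneg (by linarith) _
      simpa using mul_le_of_le_one_left this (Real.exp_le_one_iff.2 (by norm_num : (-1 : ℝ) ≤ 0))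
  have l1 : Tendsto (fun M : ℝ => ∫ u in (-1 - M)..(-1), f (u + R * Complex.I)) atTop
      (𝓝 (∫ u in Set.Iic (-1 : ℝ), f (u + R * Complex.I))) :=
    intervalIntegral_tendsto_integral_Iic _ i1
      (tendsto_atBot_add_const_left _ (-1) tendsto_neg_atTop_atBot)
  have l2 : Tendsto (fun M : ℝ => ∫ t in R..(R + M), f (((-1 : ℝ) : ℂ) + t * Complex.I)) atTop
      (𝓝 (∫ t in Set.Ioi R, f (((-1 : ℝ) : ℂ) + t * Complex.I))) :=
    intervalIntegral_tendsto_integral_Ioi _ i2 (tendsto_atTop_add_const_left _ R tendsto_id)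
  -- The far horizontal edge has length `M`, which the decay `M ^ (-3/2)` outweighs.
  have l3 : Tendsto (fun M : ℝ => ∫ u in (-1 - M)..(-1), f (u + (R + M : ℝ) * Complex.I)) atTop
      (𝓝 0) := by
    have : Tendsto (fun M : ℝ => A * M ^ (-(1 / 2) : ℝ)) atTop (𝓝 0) := by
      simpa using (tendsto_rpow_neg_atTop (y := 1 / 2) (by norm_num)).const_mul A
    refine squeeze_zero_norm' ?_ this
    filter_upwards [eventually_ge_atTop 1] with M hM
    have h := intervalIntegral.norm_integral_le_of_norm_le_const (a := -1 - M) (b := -1)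
      (f := fun u : ℝ => f (u + (R + M : ℝ) * Complex.I)) (C := A * M ^ (-(3 / 2) : ℝ)) ?_
    · refine h.trans (le_of_eq ?_)
      rw [show -1 - (-1 - M) = M by ring, abs_of_pos (by linarith), mul_assoc]
      congr 1
      nth_rw 2 [← Real.rpow_one M]
      rw [← Real.rpow_add (by linarith)]
      norm_num
    · intro u hu
      rw [Set.uIoc_of_le (by linarith)] at hu
      refine (hb _ (by simpa using hu.2) (by simp; linarith)).trans ?_
      gcongr
      simp only [Complex.add_re, Complex.ofReal_re, Complex.mul_re, Complex.I_re, mul_zero,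
        Complex.ofReal_im, Complex.I_im, mul_one, sub_self, add_zero, Complex.add_im,
        Complex.mul_im, zero_add]
      have h1 : Real.exp u ≤ 1 := Real.exp_le_one_iff.2 (by linarith [hu.2])
      have h2 : (R + M) ^ (-(3 / 2) : ℝ) ≤ M ^ (-(3 / 2) : ℝ) :=
        Real.rpow_le_rpow_of_nonpos (by linarith) (by linarith) (by norm_num)
      have h3 : 0 ≤ (R + M) ^ (-(3 / 2) : ℝ) := Real.rpow_nonneg (by linarith) _
      exact (mul_le_of_le_one_left h3 h1).trans h2
  have l4 : Tendsto (fun M : ℝ => ∫ t in R..(R + M), f ((-1 - M : ℝ) + t * Complex.I)) atTop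
      (𝓝 0) := by
    have : Tendsto (fun M : ℝ => A * (M ^ 1 * Real.exp (-M))) atTop (𝓝 0) := by
      simpa using (Real.tendsto_pow_mul_exp_neg_atTop_nhds_zero 1).const_mul A
    refine squeeze_zero_norm' ?_ this
    filter_upwards [eventually_ge_atTop 1] with M hM
    have h := intervalIntegral.norm_integral_le_of_norm_le_const (a := R) (b := R + M)
      (f := fun t : ℝ => f ((-1 - M : ℝ) + t * Complex.I)) (C := A * Real.exp (-M)) ?_
    · refine h.trans (le_of_eq ?_)
      rw [show R + M - R = M by ring, abs_of_pos (by linarith)]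
      ring
    · intro t ht
      rw [Set.uIoc_of_le (by linarith)] at ht
      refine (hb _ (by simp; linarith) (by simpa using ht.1.le)).trans ?_
      gcongr
      simp only [Complex.add_re, Complex.ofReal_re, Complex.mul_re, Complex.I_re, mul_zero,
        Complex.ofReal_im, Complex.I_im, mul_one, sub_self, add_zero, Complex.add_im,
        Complex.mul_im, zero_add]
      exact (mul_le_of_le_one_right (Real.exp_pos _).le (hpow t (by linarith [ht.1]))).trans
        (Real.exp_le_exp.2 (by linarith))
  have lim := (l1.sub l3).add ((l2.const_mul Complex.I).sub (l4.const_mul Complex.I))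
  simp only [sub_zero, mul_zero] at lim
  refine tendsto_nhds_unique lim (tendsto_const_nhds.congr' ?_)
  filter_upwards [eventually_ge_atTop 1] with M hM
  have h := Complex.integral_boundary_rect_eq_zero_of_differentiableOn f
    ⟨-1 - M, R⟩ ⟨-1, R + M⟩ (by
      intro s hs
      refine (hf s ?_).differentiableWithinAt
      have := hs.2
      simp only [Set.mem_preimage] at this
      rw [Set.uIcc_of_le (by linarith)] at this
      exact this.1)
  simp only [smul_eq_mul] at h
  rw [← h]
  ring

/-- Cauchy's theorem for the quadrant `Re s ≤ -1`, `Im s ≤ -R`. -/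
theorem integral_lower_quadrant_eq {f : ℂ → ℂ} {R A : ℝ} (hR : 1 ≤ R)
    (hf : ∀ s : ℂ, s.im ≤ -R → DifferentiableAt ℂ f s)
    (hb : ∀ s : ℂ, s.re ≤ -1 → s.im ≤ -R →
      ‖f s‖ ≤ A * (Real.exp s.re * (-s.im) ^ (-(3 / 2) : ℝ))) :
    (∫ u in Set.Iic (-1 : ℝ), f (u - R * Complex.I)) =
      Complex.I * (∫ t in Set.Iic (-R), f (((-1 : ℝ) : ℂ) + t * Complex.I)) := by
  -- Conjugation `s ↦ conj (f (conj s))` exchanges the lower and the upper quadrant.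
  have h := integral_quadrant_eq_zero
    (f := fun s => (starRingEnd ℂ) (f ((starRingEnd ℂ) s))) (A := A) hR
    (fun s hs => by
      have := (hf ((starRingEnd ℂ) s) (by simpa using hs)).conj_conj
      simpa [Function.comp_def] using this)
    (fun s h1 h2 => by
      have := hb ((starRingEnd ℂ) s) (by simpa using h1) (by simpa using h2)
      simpa using this)
  rw [integral_conj, integral_conj] at h
  have h2 := congrArg (starRingEnd ℂ) h
  simp only [map_add, map_mul, Complex.conj_conj, Complex.conj_I, map_zero, Complex.conj_ofReal] at h2
  have h3 := integral_comp_neg_Ioi R (fun t : ℝ => f (((-1 : ℝ) : ℂ) + t * Complex.I))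
  rw [← h3]
  have h4 : ∀ z : ℂ, z + R * -Complex.I = z - R * Complex.I := fun z => by ring
  simp only [h4] at h2
  simp only [Complex.ofReal_neg, neg_mul, mul_neg] at h2 ⊢
  linear_combination h2

/-- Analytic continuations to the universal cover are unique. -/
theorem IsAnalyticContinuation.unique {f : ℝ → ℂ} {F G : U → ℂ}
    (hF : IsAnalyticContinuation f F) (hG : IsAnalyticContinuation f G) : F = G := by
  have h : (fun w : ℂ => F (U.exp w)) = fun w : ℂ => G (U.exp w) := by
    refine AnalyticOnNhd.eq_of_frequently_eq (𝕜 := ℂ) (z₀ := 0)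
      (fun w _ => hF.1.analyticAt w) (fun w _ => hG.1.analyticAt w) ?_
    -- Real `w` give points of argument 0, where both functions equal `f`; the points `1 / (k + 1)`
    -- accumulate at 0.
    have hr : ∀ r : ℝ, F (U.exp r) = G (U.exp r) := by
      intro r
      have : U.exp r = U.ofPos (Real.exp r) (Real.exp_pos r) := by
        ext <;> simp [U.exp, U.ofPos]
      rw [this, hF.2, hG.2]
    have ht : Tendsto (fun k : ℕ => (((1 : ℝ) / (k + 1) : ℝ) : ℂ)) atTop (𝓝[≠] 0) := by
      refine tendsto_nhdsWithin_iff.2 ⟨?_, Eventually.of_forall fun k => ?_⟩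
      · have := (Complex.continuous_ofReal.tendsto 0).comp
          (tendsto_one_div_add_atTop_nhds_zero_nat (𝕜 := ℝ))
        simpa [Function.comp_def] using this
      · have : (0 : ℝ) < 1 / (k + 1) := by positivity
        simpa using (by positivity : (0 : ℝ) < k + 1).ne' |> fun h => by exact_mod_cast h
    exact ht.frequently (Frequently.of_forall fun k => hr _)
  funext z
  have := congrFun h (U.log z)
  simpa [U.exp_log] using this

theorem continuation_eq {f : ℝ → ℂ} {F : U → ℂ} (hF : IsAnalyticContinuation f F) :
    continuation f = F := by
  have h : ∃ F : U → ℂ, IsAnalyticContinuation f F := ⟨F, hF⟩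
  rw [continuation, dif_pos h]
  exact h.choose_spec.unique hF

end FundamentalBessel

namespace FundamentalBessel

open MeasureTheory

/-! The Mellin-Barnes integral along a loop, which converges for all arguments. -/

/-- The integral of `f` along the loop from `-∞ - iT` through `σ - iT` and `σ + iT` to
`-∞ + iT`. -/
noncomputable def loopIntegral (ρ σ T : ℝ) (f : ℂ → ℂ) : ℂ :=
  (∫ u in Set.Iic ρ, f (u - T * Complex.I))
    + (∫ u in ρ..σ, f (u - T * Complex.I))
    + Complex.I * (∫ t in (-T)..T, f (σ + t * Complex.I))
    + (∫ u in σ..ρ, f (u + T * Complex.I))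
    - (∫ u in Set.Iic ρ, f (u + T * Complex.I))

/-- The integrand of the Mellin-Barnes integral at the point `e^w` of the universal cover. -/
noncomputable def mellinBarnesIntegrand {n : ℕ} (ς : Fin n → ℤˣ) (lam : Fin n → ℂ) (w s : ℂ) : ℂ :=
  G ς lam s * Complex.exp (-((n : ℂ) * s) * w)

/-- The Bessel function at the point `e^w` of the universal cover, as a loop integral. -/
noncomputable def besselLoop {n : ℕ} (ς : Fin n → ℤˣ) (lam : Fin n → ℂ) (w : ℂ) : ℂ :=
  1 / (2 * Real.pi * Complex.I) *
    loopIntegral (-1) (radius lam) (radius lam) (mellinBarnesIntegrand ς lam w)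

theorem continuous_G_comp {n : ℕ} (ς : Fin n → ℤˣ) (lam : Fin n → ℂ) {γ : ℝ → ℂ}
    (hγ : Continuous γ) (h : ∀ u, radius lam ≤ |(γ u).im| ∨ radius lam ≤ (γ u).re) :
    Continuous fun u => G ς lam (γ u) :=
  continuous_iff_continuousAt.2 fun u =>
    ContinuousAt.comp (f := γ) (differentiableAt_G ς lam (h u)).continuousAt hγ.continuousAt

theorem differentiable_integral_ray {n : ℕ} (hn : 0 < n) (ς : Fin n → ℤˣ) (lam : Fin n → ℂ)
    (hlam : ∑ l, lam l = 0) {T : ℝ} (hT : radius lam ≤ |T|) :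
    Differentiable ℂ fun w : ℂ => ∫ u in Set.Iic (-1 : ℝ),
      mellinBarnesIntegrand ς lam w (u + T * Complex.I) := by
  have hc : Continuous fun u : ℝ => G ς lam (u + T * Complex.I) :=
    continuous_G_comp ς lam (by fun_prop) fun u => Or.inl (by simpa using hT)
  refine differentiable_integral_mul_exp (h := fun u : ℝ => -((n : ℂ) * (u + T * Complex.I)))
    hc.aestronglyMeasurable
    (by fun_prop : Continuous fun u : ℝ => -((n : ℂ) * (u + T * Complex.I))).aestronglyMeasurable
    fun B => ?_
  -- `|B| n` cancels the growth of the exponential along the ray, and the extra 1 leaves the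
  -- integrable `e^u`.
  obtain ⟨A, hA, h⟩ := exists_norm_G_le hn ς lam hlam (B := |B| * n + 1) (by positivity)
  have hT1 : 1 ≤ |T| := (one_le_radius lam).trans hT
  refine Integrable.mono' ((integrableOn_exp_Iic (-1)).const_mul
    (A * Real.exp (|B| * (n * |T|)))) (Continuous.aestronglyMeasurable (by fun_prop)) ?_
  refine (ae_restrict_iff' measurableSet_Iic).2 (ae_of_all _ fun u hu => ?_)
  have hu : u ≤ -1 := hu
  have h1 := h (u + T * Complex.I) (by simpa using hu) (by simpa using hT)
  have e1 : ((u : ℂ) + T * Complex.I).re = u := by simp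
  have e2 : ((u : ℂ) + T * Complex.I).im = T := by simp
  rw [e1, e2] at h1
  have h2 : ‖(u : ℂ) + T * Complex.I‖ ≤ -u + |T| := by
    refine (Complex.norm_le_abs_re_add_abs_im _).trans ?_
    rw [e1, e2, abs_of_nonpos (by linarith)]
  have h3 : |T| ^ (-(3 / 2) : ℝ) ≤ 1 := Real.rpow_le_one_of_one_le_of_nonpos hT1 (by norm_num)
  have h4 : B * ‖-((n : ℂ) * (u + T * Complex.I))‖ ≤ |B| * (n * (-u + |T|)) := by
    rw [norm_neg, norm_mul, Complex.norm_natCast]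
    gcongr
    exact le_abs_self B
  rw [norm_mul, norm_norm, Real.norm_of_nonneg (Real.exp_pos _).le]
  calc _ ≤ (A * (Real.exp ((|B| * n + 1) * u) * 1)) * Real.exp (|B| * (n * (-u + |T|))) := by
        refine mul_le_mul (h1.trans ?_) (Real.exp_le_exp.2 h4) (Real.exp_pos _).le (by positivity)
        gcongr
    _ = A * Real.exp ((|B| * n + 1) * u + |B| * (n * (-u + |T|))) := by
        rw [Real.exp_add]; ring
    _ = A * Real.exp (|B| * (n * |T|) + u) := by ring_nf
    _ = _ := by rw [Real.exp_add]; ring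

theorem differentiable_besselLoop {n : ℕ} (hn : 0 < n) (ς : Fin n → ℤˣ) (lam : Fin n → ℂ)
    (hlam : ∑ l, lam l = 0) : Differentiable ℂ (besselLoop ς lam) := by
  have hR := one_le_radius lam
  have habs : |radius lam| = radius lam := abs_of_nonneg (by linarith)
  have key : ∀ (γ : ℝ → ℂ), Continuous γ →
      (∀ u, radius lam ≤ |(γ u).im| ∨ radius lam ≤ (γ u).re) → ∀ a b : ℝ,
      Differentiable ℂ fun w : ℂ => ∫ u in a..b, mellinBarnesIntegrand ς lam w (γ u) := by
    intro γ hγ h a b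
    exact differentiable_intervalIntegral_mul_exp (h := fun u => -((n : ℂ) * γ u))
      (continuous_G_comp ς lam hγ h) (by fun_prop) a b
  have d1 := differentiable_integral_ray hn ς lam hlam (T := -radius lam) (by simp [habs])
  have d2 := key (fun u => u - radius lam * Complex.I) (by fun_prop)
    (fun u => Or.inl (by simp [habs])) (-1) (radius lam)
  have d3 := key (fun t => radius lam + t * Complex.I) (by fun_prop)
    (fun u => Or.inr (by simp)) (-radius lam) (radius lam)
  have d4 := key (fun u => u + radius lam * Complex.I) (by fun_prop)
    (fun u => Or.inl (by simp [habs])) (radius lam) (-1)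
  have d5 := differentiable_integral_ray hn ς lam hlam (T := radius lam) (by simp [habs])
  simp only [Complex.ofReal_neg, neg_mul, ← sub_eq_add_neg] at d1
  exact ((((d1.add d2).add (d3.const_mul _)).add d4).sub d5).const_mul _

/-- The two contours share their middle pieces; Cauchy's theorem in the two left quadrants trades
each vertical end for a horizontal ray. -/
theorem contourIntegral_eq_loopIntegral {f : ℂ → ℂ} {σ R A : ℝ} (hR : 1 ≤ R)
    (hf : ∀ s : ℂ, R ≤ |s.im| → DifferentiableAt ℂ f s)
    (hb : ∀ s : ℂ, s.re ≤ -1 → R ≤ |s.im| →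
      ‖f s‖ ≤ A * (Real.exp s.re * |s.im| ^ (-(3 / 2) : ℝ))) :
    contourIntegral (-1) σ R f = loopIntegral (-1) σ R f := by
  have h1 := integral_quadrant_eq_zero (f := f) (A := A) hR
    (fun s hs => hf s (hs.trans (le_abs_self _)))
    (fun s h1 h2 => by
      have := hb s h1 (h2.trans (le_abs_self _))
      rwa [abs_of_nonneg (by linarith)] at this)
  have h2 := integral_lower_quadrant_eq (f := f) (A := A) hR
    (fun s hs => hf s (by rw [abs_of_nonpos (by linarith)]; linarith))
    (fun s h1 h2 => by
      have := hb s h1 (by rw [abs_of_nonpos (by linarith)]; linarith)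
      rwa [abs_of_nonpos (by linarith)] at this)
  rw [contourIntegral, loopIntegral, h2]
  linear_combination h1

theorem besselJPos_eq_besselLoop {n : ℕ} (hn : 0 < n) (ς : Fin n → ℤˣ) (lam : Fin n → ℂ)
    (hlam : ∑ l, lam l = 0) {x : ℝ} (hx : 0 < x) :
    besselJPos ς lam x = besselLoop ς lam (Real.log x : ℝ) := by
  have hfun : (fun s => G ς lam s * (x : ℂ) ^ (-((n : ℂ) * s))) =
      mellinBarnesIntegrand ς lam (Real.log x : ℝ) := by
    funext s
    rw [mellinBarnesIntegrand, Complex.cpow_def_of_ne_zero (by exact_mod_cast hx.ne'),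
      ← Complex.ofReal_log hx.le, mul_comm (Real.log x : ℂ)]
  -- `|x ^ (-n s)| ≤ e^{-n Re s |log x|}` for `Re s ≤ -1`, so a factor `e^{Re s}` remains.
  obtain ⟨A, hA, h⟩ := exists_norm_G_le hn ς lam hlam (B := n * |Real.log x| + 1) (by positivity)
  rw [besselJPos, besselLoop, hfun, contourIntegral_eq_loopIntegral (A := A) (one_le_radius lam)]
  · intro s hs
    unfold mellinBarnesIntegrand
    exact (differentiableAt_G ς lam (Or.inl hs)).mul (by fun_prop)
  · intro s h1 h2
    rw [mellinBarnesIntegrand, norm_mul, Complex.norm_exp]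
    have e1 : (-((n : ℂ) * s) * (Real.log x : ℝ)).re = n * (-s.re * Real.log x) := by
      rw [Complex.re_mul_ofReal, Complex.neg_re, ← Complex.ofReal_natCast,
        Complex.re_ofReal_mul]; ring
    have h3 : -s.re * Real.log x ≤ -s.re * |Real.log x| :=
      mul_le_mul_of_nonneg_left (le_abs_self _) (by linarith)
    calc _ ≤ (A * (Real.exp ((n * |Real.log x| + 1) * s.re) * |s.im| ^ (-(3 / 2) : ℝ))) *
          Real.exp (n * (-s.re * |Real.log x|)) := by
          gcongr
          · exact h s h1 h2
          · rw [e1]; gcongr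
      _ = A * ((Real.exp ((n * |Real.log x| + 1) * s.re) *
          Real.exp (n * (-s.re * |Real.log x|))) * |s.im| ^ (-(3 / 2) : ℝ)) := by ring
      _ = _ := by rw [← Real.exp_add]; ring_nf

theorem isAnalyticContinuation_besselLoop {n : ℕ} (hn : 0 < n) (ς : Fin n → ℤˣ) (lam : Fin n → ℂ)
    (hlam : ∑ l, lam l = 0) :
    IsAnalyticContinuation (besselJPos ς lam) fun z => besselLoop ς lam z.log := by
  refine ⟨?_, fun x hx => ?_⟩
  · simp only [IsHolomorphic, U.log_exp]
    exact differentiable_besselLoop hn ς lam hlam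
  · rw [besselJPos_eq_besselLoop hn ς lam hlam hx]
    rfl

theorem besselJ_eq_besselLoop {n : ℕ} (hn : 0 < n) (ς : Fin n → ℤˣ) (lam : Fin n → ℂ)
    (hlam : ∑ l, lam l = 0) (z : U) : besselJ ς lam z = besselLoop ς lam z.log := by
  rw [besselJ, continuation_eq (isAnalyticContinuation_besselLoop hn ς lam hlam)]

/-! ### Changing the signs under the integral. -/

theorem loopIntegral_const_mul (ρ σ T : ℝ) (c : ℂ) (f : ℂ → ℂ) :
    loopIntegral ρ σ T (fun s => c * f s) = c * loopIntegral ρ σ T f := by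
  simp only [loopIntegral, integral_const_mul, intervalIntegral.integral_const_mul]
  ring

theorem prod_e {ι : Type*} (s : Finset ι) (a : ι → ℂ) : ∏ i ∈ s, e (a i) = e (∑ i ∈ s, a i) := by
  simp only [e, Finset.mul_sum, Complex.exp_sum]

theorem sum_sign_mul {n : ℕ} (ε : ℤˣ) (ς : Fin n → ℤˣ) (a : Fin n → ℂ) :
    ∑ l, ((ς l : ℤ) : ℂ) * a l =
      ((ε : ℤ) : ℂ) * (∑ l, a l - 2 * ∑ l ∈ L (-ε) ς, a l) := by
  rw [L, Finset.sum_filter, Finset.mul_sum, ← Finset.sum_sub_distrib, Finset.mul_sum]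
  refine Finset.sum_congr rfl fun l _ => ?_
  rcases Int.units_eq_one_or (ς l) with h | h <;> rcases Int.units_eq_one_or ε with h' | h' <;>
    rw [h, h'] <;> simp <;> ring

theorem mellinBarnesIntegrand_eq {n : ℕ} (hn : 0 < n) (ς : Fin n → ℤˣ) (lam : Fin n → ℂ) (ε : ℤˣ)
    (w s : ℂ) :
    mellinBarnesIntegrand ς lam w s =
      e (((ε : ℤ) : ℂ) * ((∑ l ∈ L (-ε) ς, lam l) / 2)) *
        mellinBarnesIntegrand (fun _ => ε) lam
          (((ε : ℤ) : ℂ) * (Real.pi * Complex.I * ((L (-ε) ς).card / (n : ℂ))) + w) s := by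
  have hn' : (n : ℂ) ≠ 0 := by exact_mod_cast hn.ne'
  have h1 : ∀ ς' : Fin n → ℤˣ, G ς' lam s =
      (∏ l, Complex.Gamma (s - lam l)) * e ((∑ l, ((ς' l : ℤ) : ℂ) * (s - lam l)) / 4) := by
    intro ς'
    rw [G, Finset.prod_mul_distrib, prod_e, Finset.sum_div]
  have h2 : ∑ l ∈ L (-ε) ς, (s - lam l) = (L (-ε) ς).card * s - ∑ l ∈ L (-ε) ς, lam l := by
    rw [Finset.sum_sub_distrib, Finset.sum_const, nsmul_eq_mul]
  have h3 : e ((∑ l, ((ς l : ℤ) : ℂ) * (s - lam l)) / 4) * Complex.exp (-((n : ℂ) * s) * w) =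
      e (((ε : ℤ) : ℂ) * ((∑ l ∈ L (-ε) ς, lam l) / 2)) *
        (e ((∑ l, ((ε : ℤ) : ℂ) * (s - lam l)) / 4) * Complex.exp (-((n : ℂ) * s) *
          (((ε : ℤ) : ℂ) * (Real.pi * Complex.I * ((L (-ε) ς).card / (n : ℂ))) + w))) := by
    rw [sum_sign_mul ε ς, h2, ← Finset.mul_sum]
    simp only [e, ← Complex.exp_add]
    congr 1
    field_simp
    ring
  rw [mellinBarnesIntegrand, mellinBarnesIntegrand, h1, h1]
  linear_combination (∏ l, Complex.Gamma (s - lam l)) * h3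

/-- The loop depends on `lam` but not on the signs or on `w`, so the identity of integrands
integrates without moving the contour. -/
theorem besselLoop_eq {n : ℕ} (hn : 0 < n) (ς : Fin n → ℤˣ) (lam : Fin n → ℂ) (ε : ℤˣ) (w : ℂ) :
    besselLoop ς lam w =
      e (((ε : ℤ) : ℂ) * ((∑ l ∈ L (-ε) ς, lam l) / 2)) *
        besselLoop (fun _ => ε) lam
          (((ε : ℤ) : ℂ) * (Real.pi * Complex.I * ((L (-ε) ς).card / (n : ℂ))) + w) := by
  rw [besselLoop, besselLoop, mul_left_comm (e _), ← loopIntegral_const_mul (c := e _)]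
  congr 2
  funext s
  exact mellinBarnesIntegrand_eq hn ς lam ε w s

end FundamentalBessel

theorem lemma7 {n : ℕ} (hn : 0 < n) (ς : Fin n → ℤˣ) (lam : Fin n → ℂ) (hlam : ∑ l, lam l = 0) :
    (∃! F : U → ℂ, IsAnalyticContinuation (besselJPos ς lam) F) ∧
      ∀ (ε : ℤˣ) (z : U),
        besselJ ς lam z =
          e (((ε : ℤ) : ℂ) * ((∑ l ∈ L (-ε) ς, lam l) / 2)) *
            besselH ε lam
              (U.exp (((ε : ℤ) : ℂ) * (Real.pi * Complex.I * ((L (-ε) ς).card / (n : ℂ)))) * z) := by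
  have hF := isAnalyticContinuation_besselLoop hn ς lam hlam
  refine ⟨⟨_, hF, fun F' hF' => hF'.unique hF⟩, fun ε z => ?_⟩
  rw [besselH, besselJ_eq_besselLoop hn ς lam hlam, besselJ_eq_besselLoop hn _ lam hlam, U.log_mul,
    U.log_exp]
  exact besselLoop_eq hn ς lam ε z.log
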